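/- Consider the nonrelativistic Smoluchowski–Poisson system $$x'=y-x,\qquad y'=(2-x)y,$$ that is, the system $x'=y-x$, $y'=a(x)y-b(x)y^2$ with $a(x)=2-x$ and $b(x)=0$. A heteroclinic trajectory joining $(0,0)$ with $(2,2)$ is a solution $(x(t),y(t))$, $t\in\mathbb R$, with $(x(t),y(t))\to(0,0)$ as $t\to-\infty$ and $(x(t),y(t))\to(2,2)$ as $t\to+\infty$. Let $z=2$ and $H(x)=zB(x)-A(x)$, where $A'=a$, $B'=b$ and $A(z)=B(z)=0$. Then a heteroclinic trajectory joining $(0,0)$ with $(2,2)$ exists; $2H(x)=(x-2)^2$ for $x\ge 2$; $H$ maps $[2,\infty)$ bijectively onto $[0,\infty)$, with inverse $H^{-1}(h)=2+\sqrt{2h}$ for $h\ge 0$; $4-2\log 3\ge 0$; and with $$X=H^{-1}(4-2\log 3)=2+2\sqrt{2-\log 3}$$ every heteroclinic trajectory joining $(0,0)$ with $(2,2)$ satisfies $x(t)\le X$ for all $t\in\mathbb R$. -/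

import Mathlib

open Set Filter Topology

namespace SmoluchowskiPoisson

/-- `t ↦ (x t, y t)` is a solution, defined for all times, of the system
`x' = y - x`, `y' = a(x) y - b(x) y²`. -/
def IsTrajectory (a b : ℝ → ℝ) (x y : ℝ → ℝ) : Prop :=
  ∀ t : ℝ, HasDerivAt x (y t - x t) t ∧
    HasDerivAt y (a (x t) * y t - b (x t) * y t ^ 2) t

/-- A heteroclinic trajectory of the system from the point `p` to the point `q`: a trajectory
with limit `p` as `t → -∞` and limit `q` as `t → ∞`. -/
def IsHeteroclinic (a b : ℝ → ℝ) (p q : ℝ × ℝ) (x y : ℝ → ℝ) : Prop :=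
  IsTrajectory a b x y ∧
    Tendsto (fun t => (x t, y t)) atBot (𝓝 p) ∧
    Tendsto (fun t => (x t, y t)) atTop (𝓝 q)

/-- `H(x) = z B(x) - A(x)`, where `A' = a`, `B' = b` and `A(z) = B(z) = 0`. -/
noncomputable def H (a b : ℝ → ℝ) (z : ℝ) (x : ℝ) : ℝ :=
  z * (∫ s in z..x, b s) - ∫ s in z..x, a s

/-- The coefficient `a(x) = 2 - x` of the nonrelativistic case. -/
def aNR (x : ℝ) : ℝ := 2 - x

/-- The coefficient `b(x) = 0` of the nonrelativistic case. -/
def bNR (_x : ℝ) : ℝ := 0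

end SmoluchowskiPoisson

/-! Existence: at the origin the linearization has eigenvalues -1 and 2, the latter with eigenvector
(1, 3). Its unstable branch is written as a power series in e^{2t}, with coefficients bounded by 1
(`abs_coeff_le_one`), which solves the system near t = -∞ with y > 0. Forward in time, V = (x-2)²/2
+ y - 2 log y satisfies V' = -(x-2)²; it confines (x, log y) to a bounded set, so the solution is
global, and its decay forces convergence to (2, 2). The two pieces are glued.

Bound: a heteroclinic has y > 0 and stays below the eigendirection, y ≤ 3x
(`le_three_mul_of_tendsto_zero`). If x(t) > 2, let r be the last earlier time with x(r) = 2; then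
x'(r) ≥ 0, so 2 ≤ y(r) ≤ 6. As v - 2 log v increases on [2, 6] and has its minimum over v > 0 at 2,
the inequality V(t) ≤ V(r) gives H(x(t)) ≤ (6 - 2 log 6) - (2 - 2 log 2) = 4 - 2 log 3. -/

namespace SmoluchowskiPoisson

/-! ### General tools: global flows and a Barbalat-type lemma -/

/-- A bounded Lipschitz vector field has a global integral curve through every point. -/
theorem exists_global_solution {E : Type*} [NormedAddCommGroup E] [NormedSpace ℝ E]
    [CompleteSpace E] {f : E → E} {K L : NNReal} (hK : LipschitzWith K f)
    (hL : ∀ z, ‖f z‖ ≤ L) (z₀ : E) :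
    ∃ γ : ℝ → E, γ 0 = z₀ ∧ ∀ t, HasDerivAt γ (f (γ t)) t := by
  have key : ∀ a : ℝ, ∃ γ : ℝ → E, 0 < a →
      γ 0 = z₀ ∧ ∀ t ∈ Ioo (-a) a, HasDerivAt γ (f (γ t)) t := by
    intro a
    by_cases ha : 0 < a
    swap
    · exact ⟨fun _ => z₀, fun h => absurd h ha⟩
    have h0 : (0 : ℝ) ∈ Icc (-a) a := ⟨by linarith, ha.le⟩
    -- In time a, speed at most L cannot leave the ball of radius L * a, so Picard–Lindelöf covers
    -- all of [-a, a].
    have hP : IsPicardLindelof (fun _ => f) (⟨0, h0⟩ : Icc (-a) a) z₀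
        (L * ⟨a, ha.le⟩) 0 L K :=
      IsPicardLindelof.of_time_independent (fun z _ => hL z) hK.lipschitzOnWith (by
        simp only [sub_zero, zero_sub, neg_neg, max_self, NNReal.coe_zero]
        rfl)
    obtain ⟨γ, hγ0, hγ⟩ := hP.exists_eq_forall_mem_Icc_hasDerivWithinAt₀
    exact ⟨γ, fun _ => ⟨hγ0, fun t ht =>
      (hγ t (Ioo_subset_Icc_self ht)).hasDerivAt (Icc_mem_nhds ht.1 ht.2)⟩⟩
  choose γ hγ using key
  have huniq : ∀ a b t : ℝ, |t| < a → |t| < b → γ a t = γ b t := by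
    intro a b t hta htb
    have ht := abs_nonneg t
    have hm : |t| < min a b := lt_min hta htb
    refine ODE_solution_unique_of_mem_Ioo (v := fun _ => f) (s := fun _ => univ) (t₀ := 0)
      (a := -min a b) (b := min a b) (K := K) (fun _ _ => hK.lipschitzOnWith)
      ⟨by linarith, by linarith⟩ (fun s hs => ⟨?_, trivial⟩) (fun s hs => ⟨?_, trivial⟩)
      ?_ (abs_lt.1 hm)
    · have := min_le_left a b
      exact (hγ a (by linarith)).2 s ⟨by linarith [hs.1], by linarith [hs.2]⟩
    · have := min_le_right a b
      exact (hγ b (by linarith)).2 s ⟨by linarith [hs.1], by linarith [hs.2]⟩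
    · rw [(hγ a (by linarith)).1, (hγ b (by linarith)).1]
  -- By uniqueness the curves agree where they overlap, so any interval containing t may be used to
  -- define the value at t.
  refine ⟨fun t => γ (|t| + 1) t, (hγ _ (by positivity)).1, fun t => ?_⟩
  refine ((hγ (|t| + 1) (by positivity)).2 t (abs_lt.1 (by linarith))).congr_of_eventuallyEq ?_
  have : ∀ᶠ s in 𝓝 t, |s| < |t| + 1 :=
    continuous_abs.continuousAt.eventually (gt_mem_nhds (by linarith))
  filter_upwards [this] with s hs
  exact huniq _ _ s (by linarith) hs

/-- A function with a limit at infinity and a bounded second derivative has a first derivative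
tending to zero. -/
theorem tendsto_deriv_zero_of_tendsto {f f' f'' : ℝ → ℝ} {l K : ℝ}
    (hf : ∀ t, 0 ≤ t → HasDerivAt f (f' t) t) (hf' : ∀ t, 0 ≤ t → HasDerivAt f' (f'' t) t)
    (hK : ∀ t, 0 ≤ t → |f'' t| ≤ K) (hl : Tendsto f atTop (𝓝 l)) :
    Tendsto f' atTop (𝓝 0) := by
  have hK0 : 0 ≤ K := (abs_nonneg _).trans (hK 0 le_rfl)
  rw [Metric.tendsto_atTop]
  intro ε hε
  -- Over a step δ, f' varies by at most K * δ ≤ ε / 2; K + 1 avoids dividing by zero.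
  set δ := ε / (2 * (K + 1)) with hδ
  have hδ0 : 0 < δ := by positivity
  have hKδ : K * δ ≤ ε / 2 := by
    rw [hδ, mul_div_assoc', div_le_div_iff₀ (by positivity) (by norm_num)]
    nlinarith
  have hshift : Tendsto (fun t => (f (t + δ) - f t) / δ) atTop (𝓝 0) := by
    have h1 : Tendsto (fun t => f (t + δ)) atTop (𝓝 l) :=
      hl.comp (tendsto_atTop_add_const_right _ _ tendsto_id)
    simpa using (h1.sub hl).div_const δ
  obtain ⟨N, hN⟩ := (Metric.tendsto_atTop.1 hshift) (ε / 2) (by positivity)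
  refine ⟨max N 0, fun t ht => ?_⟩
  have ht0 : 0 ≤ t := (le_max_right _ _).trans ht
  have hNt := hN t ((le_max_left _ _).trans ht)
  obtain ⟨ξ, hξ, hξe⟩ := exists_hasDerivAt_eq_slope f f' (show t < t + δ by linarith)
    (fun s hs => (hf s (ht0.trans hs.1)).continuousAt.continuousWithinAt)
    (fun s hs => hf s (ht0.trans hs.1.le))
  obtain ⟨η, hη, hηe⟩ := exists_hasDerivAt_eq_slope f' f'' hξ.1
    (fun s hs => (hf' s (ht0.trans hs.1)).continuousAt.continuousWithinAt)
    (fun s hs => hf' s (ht0.trans hs.1.le))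
  have hη' : f' ξ - f' t = f'' η * (ξ - t) := by
    rw [hηe, div_mul_cancel₀ _ (sub_pos.2 hξ.1).ne']
  have h2 : |f' ξ - f' t| ≤ K * δ := by
    rw [hη', abs_mul, abs_of_pos (sub_pos.2 hξ.1)]
    exact mul_le_mul (hK η (ht0.trans hη.1.le)) (by linarith [hξ.2]) (sub_pos.2 hξ.1).le hK0
  rw [show t + δ - t = δ by ring] at hξe
  rw [Real.dist_eq, sub_zero] at hNt ⊢
  rw [← hξe] at hNt
  have := abs_lt.1 hNt
  have := abs_le.1 h2
  rw [abs_lt]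
  constructor <;> linarith

/-! ### The unstable branch at the origin as a series in e^{2t} -/

/-- Coefficients of the expansion `x(t) = ∑ cₙ e^{2(n+1)t}` of the trajectory on the unstable
manifold of the origin. -/
noncomputable def coeff : ℕ → ℝ
  | 0 => 1
  | n + 1 => -(∑ i : Fin (n + 1), coeff i * ((2 * (n - i : ℕ) + 3) * coeff (n - i))) /
      (2 * (n + 1) * (2 * n + 5))

theorem coeff_zero : coeff 0 = 1 := by rw [coeff]

/-- This is the coefficient of e^{2(n+2)t} in y' = (2 - x) y, where y = x' + x has coefficients
(2n+3) cₙ. -/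
theorem coeff_succ (n : ℕ) :
    2 * (n + 1) * (2 * n + 5) * coeff (n + 1) =
      -∑ p ∈ Finset.HasAntidiagonal.antidiagonal n, coeff p.1 * ((2 * p.2 + 3) * coeff p.2) := by
  rw [coeff, mul_div_cancel₀ _ (by positivity), Finset.Nat.sum_antidiagonal_eq_sum_range_succ
    (fun i j => coeff i * ((2 * (j : ℝ) + 3) * coeff j)), Finset.sum_range]

theorem sum_antidiagonal_two_mul_add_three (n : ℕ) :
    ∑ p ∈ Finset.HasAntidiagonal.antidiagonal n, (2 * (p.2 : ℝ) + 3) = (n + 1) * (n + 3) := by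
  rw [Finset.Nat.sum_antidiagonal_eq_sum_range_succ (fun _ j => 2 * (j : ℝ) + 3),
    ← Finset.sum_range_reflect]
  have : ∀ m : ℕ, ∑ j ∈ Finset.range m, (2 * (j : ℝ) + 3) = m * (m + 2) := by
    intro m
    induction m with
    | zero => simp
    | succ k ih => rw [Finset.sum_range_succ, ih]; push_cast; ring
  rw [Finset.sum_congr rfl (g := fun j : ℕ => 2 * (j : ℝ) + 3), this]
  · push_cast; ring
  · intro j hj
    rw [Finset.mem_range] at hj
    rw [show n - (n.succ - 1 - j) = j by omega]

/-- By strong induction the convolution is at most (n+1)(n+3), which the factor 2(n+1)(2n+5)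
exceeds. -/
theorem abs_coeff_le_one (n : ℕ) : |coeff n| ≤ 1 := by
  induction n using Nat.strong_induction_on with
  | _ n ih =>
    rcases n with _ | n
    · simp [coeff_zero]
    have h1 : |∑ p ∈ Finset.HasAntidiagonal.antidiagonal n, coeff p.1 * ((2 * (p.2 : ℝ) + 3) * coeff p.2)|
        ≤ (n + 1) * (n + 3) := by
      rw [← sum_antidiagonal_two_mul_add_three]
      refine (Finset.abs_sum_le_sum_abs _ _).trans (Finset.sum_le_sum fun p hp => ?_)
      have hp' := Finset.HasAntidiagonal.mem_antidiagonal.1 hp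
      rw [abs_mul, abs_mul, abs_of_nonneg (by positivity : (0 : ℝ) ≤ 2 * p.2 + 3)]
      have e1 := ih p.1 (by omega)
      have e2 := ih p.2 (by omega)
      calc |coeff p.1| * ((2 * p.2 + 3) * |coeff p.2|) ≤ 1 * ((2 * p.2 + 3) * 1) := by gcongr
        _ = _ := by ring
    have h2 := congrArg abs (coeff_succ n)
    rw [abs_neg, abs_mul, abs_of_nonneg (by positivity : (0 : ℝ) ≤ 2 * (n + 1) * (2 * n + 5))]
      at h2
    rw [← h2] at h1
    by_contra! h
    nlinarith [mul_pos (by positivity : (0 : ℝ) < 2 * (n + 1) * (2 * n + 5)) (sub_pos.2 h)]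

/-- The series `∑ dₙ e^{2(n+1)t}`. -/
noncomputable def expSeries (d : ℕ → ℝ) (t : ℝ) : ℝ :=
  ∑' n : ℕ, d n * Real.exp (2 * t) ^ (n + 1)

section expSeries

variable {d : ℕ → ℝ} {C t : ℝ} {k : ℕ}

theorem summable_polynomial_growth_mul_geometric (k : ℕ) (C : ℝ) {r : ℝ} (hr0 : 0 ≤ r)
    (hr : r < 1) : Summable fun n : ℕ => C * ((n : ℝ) + 1) ^ k * r ^ (n + 1) := by
  have h := (summable_nat_add_iff 1).2 (summable_pow_mul_geometric_of_norm_lt_one k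
    (r := r) (by rwa [Real.norm_of_nonneg hr0]))
  simpa [mul_assoc] using h.mul_left C

theorem summable_norm_expSeries (hd : ∀ n : ℕ, |d n| ≤ C * (n + 1) ^ k) (ht : t < 0) :
    Summable fun n : ℕ => ‖d n * Real.exp (2 * t) ^ (n + 1)‖ := by
  refine Summable.of_nonneg_of_le (fun _ => norm_nonneg _) (fun n => ?_)
    (summable_polynomial_growth_mul_geometric k C (Real.exp_pos (2 * t)).le
      (Real.exp_lt_one_iff.2 (by linarith)))
  rw [norm_mul, Real.norm_eq_abs, Real.norm_of_nonneg (by positivity)]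
  gcongr
  exact hd n

theorem hasDerivAt_expSeries (hd : ∀ n : ℕ, |d n| ≤ C * (n + 1) ^ k) (ht : t < 0) :
    HasDerivAt (expSeries d) (expSeries (fun n => 2 * (n + 1) * d n) t) t := by
  have hr0 := (Real.exp_pos t).le
  have hr1 : Real.exp t < 1 := Real.exp_lt_one_iff.2 ht
  -- For s < t/2 one has e^{2s} < e^t < 1, which gives a uniform geometric majorant.
  refine hasDerivAt_tsum_of_isPreconnected (t := Iio (t / 2)) (y₀ := t)
    (g := fun (n : ℕ) s => d n * Real.exp (2 * s) ^ (n + 1))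
    (g' := fun (n : ℕ) s => 2 * (n + 1) * d n * Real.exp (2 * s) ^ (n + 1))
    (summable_polynomial_growth_mul_geometric (k + 1) (2 * C) hr0 hr1) isOpen_Iio
    isPreconnected_Iio (fun n s _ => ?_) (fun n s hs => ?_) (by simp; linarith)
    (summable_norm_expSeries hd ht).of_norm (by simp; linarith)
  · have h1 : HasDerivAt (fun s => Real.exp (2 * s)) (Real.exp (2 * s) * (2 * 1)) s :=
      ((hasDerivAt_id s).const_mul 2).exp
    refine ((h1.fun_pow (n + 1)).const_mul (d n)).congr_deriv ?_
    push_cast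
    rw [pow_succ]
    ring
  · rw [norm_mul, Real.norm_eq_abs, Real.norm_of_nonneg (by positivity), abs_mul,
      abs_of_nonneg (by positivity : (0 : ℝ) ≤ 2 * (n + 1))]
    have hs' : Real.exp (2 * s) ≤ Real.exp t := Real.exp_le_exp.2 (by
      have := mem_Iio.1 hs; linarith)
    calc 2 * ((n : ℝ) + 1) * |d n| * Real.exp (2 * s) ^ (n + 1)
        ≤ 2 * (n + 1) * (C * (n + 1) ^ k) * Real.exp t ^ (n + 1) :=
          mul_le_mul (mul_le_mul_of_nonneg_left (hd n) (by positivity))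
            (pow_le_pow_left₀ (Real.exp_pos _).le hs' _) (by positivity)
            (mul_nonneg (by positivity) ((abs_nonneg _).trans (hd n)))
      _ = _ := by ring

theorem tendsto_exp_two_mul_atBot : Tendsto (fun t : ℝ => Real.exp (2 * t)) atBot (𝓝 0) :=
  Real.tendsto_exp_atBot.comp (tendsto_id.const_mul_atBot two_pos)

/-- The leading term dominates as t → -∞; this determines the sign of y there. -/
theorem tendsto_expSeries_div (hd : ∀ n : ℕ, |d n| ≤ C * (n + 1) ^ k) :
    Tendsto (fun t => expSeries d t / Real.exp (2 * t)) atBot (𝓝 (d 0)) := by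
  have h1 : ∀ t, expSeries d t / Real.exp (2 * t) = ∑' n : ℕ, d n * Real.exp (2 * t) ^ n := by
    intro t
    rw [expSeries, ← tsum_div_const]
    refine tsum_congr fun n => ?_
    rw [pow_succ]
    field_simp
  have h2 : d 0 = ∑' n : ℕ, d n * (0 : ℝ) ^ n := by
    rw [tsum_eq_single 0 (fun n hn => by simp [hn])]
    simp
  simp_rw [h1]
  rw [h2]
  -- For t ≤ -1/2 the ratio is at most e^{-1}; the factor e compensates for the exponent n in place
  -- of n + 1.
  have hs := (summable_polynomial_growth_mul_geometric k C (Real.exp_pos (-1)).le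
    (Real.exp_lt_one_iff.2 (by norm_num))).mul_right (Real.exp 1)
  refine tendsto_tsum_of_dominated_convergence hs
    (fun n => (tendsto_exp_two_mul_atBot.pow n).const_mul (d n)) ?_
  filter_upwards [eventually_le_atBot (-1 / 2 : ℝ)] with t ht n
  rw [norm_mul, Real.norm_eq_abs, Real.norm_of_nonneg (by positivity), pow_succ, mul_assoc,
    mul_assoc (Real.exp (-1) ^ n), ← Real.exp_add]
  have ht' : Real.exp (2 * t) ≤ Real.exp (-1) := Real.exp_le_exp.2 (by linarith)
  calc |d n| * Real.exp (2 * t) ^ n ≤ (C * (n + 1) ^ k) * Real.exp (-1) ^ n :=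
        mul_le_mul (hd n) (pow_le_pow_left₀ (Real.exp_pos _).le ht' _) (by positivity)
          ((abs_nonneg _).trans (hd n))
    _ = _ := by simp

theorem tendsto_expSeries (hd : ∀ n : ℕ, |d n| ≤ C * (n + 1) ^ k) :
    Tendsto (expSeries d) atBot (𝓝 0) := by
  have := (tendsto_expSeries_div hd).mul tendsto_exp_two_mul_atBot
  rw [mul_zero] at this
  refine this.congr fun t => ?_
  field_simp

end expSeries

/-- Near `t = -∞` there is a positive trajectory emanating from the origin. -/
theorem exists_backward_solution :
    ∃ (T : ℝ) (x y : ℝ → ℝ), 0 < y T ∧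
      (∀ t ≤ T, HasDerivAt x (y t - x t) t ∧ HasDerivAt y ((2 - x t) * y t) t) ∧
      Tendsto x atBot (𝓝 0) ∧ Tendsto y atBot (𝓝 0) := by
  set e : ℕ → ℝ := fun n => (2 * n + 3) * coeff n with he
  have hc : ∀ n : ℕ, |coeff n| ≤ 1 * (n + 1 : ℝ) ^ 0 := fun n => by
    simpa using abs_coeff_le_one n
  have hb : ∀ n : ℕ, |e n| ≤ 3 * (n + 1 : ℝ) ^ 1 := fun n => by
    rw [he]
    simp only
    rw [abs_mul, abs_of_nonneg (by positivity : (0 : ℝ) ≤ 2 * n + 3)]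
    calc (2 * (n : ℝ) + 3) * |coeff n| ≤ (2 * n + 3) * 1 := by
          gcongr
          exact abs_coeff_le_one n
      _ ≤ _ := by linarith [(Nat.cast_nonneg n : (0 : ℝ) ≤ n)]
  have hpos : ∀ᶠ t in atBot, 0 < expSeries e t := by
    have h3 : (0 : ℝ) < e 0 := by simp [he, coeff_zero]
    filter_upwards [(tendsto_expSeries_div hb).eventually (lt_mem_nhds h3)] with t ht
    rw [div_pos_iff_of_pos_right (Real.exp_pos _)] at ht
    exact ht
  obtain ⟨T, hT, hT0⟩ := (hpos.and (eventually_lt_atBot (0 : ℝ))).exists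
  refine ⟨T, expSeries coeff, expSeries e, hT, fun t ht => ?_, tendsto_expSeries hc,
    tendsto_expSeries hb⟩
  have ht0 : t < 0 := ht.trans_lt hT0
  have sc := summable_norm_expSeries hc ht0
  have se := summable_norm_expSeries hb ht0
  constructor
  · convert hasDerivAt_expSeries hc ht0 using 1
    rw [expSeries, expSeries, ← se.of_norm.tsum_sub sc.of_norm, expSeries]
    refine tsum_congr fun n => ?_
    rw [he]
    ring
  · convert hasDerivAt_expSeries hb ht0 using 1
    have hb' : ∀ n : ℕ, |2 * (n + 1) * e n| ≤ 6 * (n + 1 : ℝ) ^ 2 := fun n => by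
      rw [abs_mul, abs_of_nonneg (by positivity : (0 : ℝ) ≤ 2 * (n + 1))]
      calc 2 * ((n : ℝ) + 1) * |e n| ≤ 2 * (n + 1) * (3 * (n + 1 : ℝ) ^ 1) := by
            gcongr
            exact hb n
        _ = _ := by ring
    have sb := summable_norm_expSeries hb' ht0
    have hdiff : 2 * expSeries e t - expSeries (fun n => 2 * (n + 1) * e n) t =
        expSeries coeff t * expSeries e t := by
      rw [expSeries, expSeries, expSeries,
        tsum_mul_tsum_eq_tsum_sum_antidiagonal_of_summable_norm sc se, ← tsum_mul_left,
        ← (se.of_norm.mul_left 2).tsum_sub sb.of_norm,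
        ((se.of_norm.mul_left 2).sub sb.of_norm).tsum_eq_zero_add]
      simp only [CharP.cast_eq_zero, zero_add, mul_one]
      -- The lowest-order term vanishes because 2 is an eigenvalue.
      rw [sub_eq_zero_of_eq (by ring), zero_add]
      refine tsum_congr fun n => ?_
      have hn := coeff_succ n
      have : ∑ p ∈ Finset.HasAntidiagonal.antidiagonal n, coeff p.1 * Real.exp (2 * t) ^ (p.1 + 1) *
          (e p.2 * Real.exp (2 * t) ^ (p.2 + 1)) =
          (∑ p ∈ Finset.HasAntidiagonal.antidiagonal n, coeff p.1 * ((2 * (p.2 : ℝ) + 3) * coeff p.2)) *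
            Real.exp (2 * t) ^ (n + 2) := by
        rw [Finset.sum_mul]
        refine Finset.sum_congr rfl fun p hp => ?_
        rw [← Finset.HasAntidiagonal.mem_antidiagonal.1 hp, he]
        ring
      rw [this, neg_eq_iff_eq_neg.1 hn.symm, he]
      push_cast
      ring
    rw [← sub_eq_zero] at hdiff ⊢
    linarith

/-! ### Forward existence and convergence to (2, 2) -/

/-- Truncation of a real number to `[-M, M]`. -/
noncomputable def clamp (M u : ℝ) : ℝ := max (-M) (min u M)

theorem clamp_of_abs_le {M u : ℝ} (h : |u| ≤ M) : clamp M u = u := by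
  obtain ⟨h1, h2⟩ := abs_le.1 h
  rw [clamp, min_eq_left h2, max_eq_right h1]

theorem abs_clamp_le {M : ℝ} (hM : 0 ≤ M) (u : ℝ) : |clamp M u| ≤ M :=
  abs_le.2 ⟨le_max_left _ _, max_le (by linarith) (min_le_right _ _)⟩

theorem abs_clamp_sub_clamp_le (M u v : ℝ) : |clamp M u - clamp M v| ≤ |u - v| := by
  have h1 := abs_max_sub_max_le_max (-M) (min u M) (-M) (min v M)
  have h2 := abs_min_sub_min_le_max u M v M
  rw [sub_self, abs_zero] at h1 h2
  exact h1.trans (max_le (abs_nonneg _) (h2.trans (max_le le_rfl (abs_nonneg _))))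

theorem abs_exp_sub_exp_le {M a b : ℝ} (ha : a ≤ M) (hb : b ≤ M) :
    |Real.exp a - Real.exp b| ≤ Real.exp M * |a - b| := by
  wlog hab : b ≤ a generalizing a b
  · rw [abs_sub_comm, abs_sub_comm a]
    exact this hb ha (le_of_not_ge hab)
  rw [abs_of_nonneg (sub_nonneg.2 (Real.exp_le_exp.2 hab)), abs_of_nonneg (sub_nonneg.2 hab)]
  have h1 := Real.add_one_le_exp (b - a)
  have h2 : Real.exp b = Real.exp a * Real.exp (b - a) := by rw [← Real.exp_add]; ring_nf
  have h3 := Real.exp_le_exp.2 ha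
  calc Real.exp a - Real.exp b ≤ Real.exp a * (a - b) := by
        rw [h2]
        nlinarith [Real.exp_pos a]
    _ ≤ _ := mul_le_mul_of_nonneg_right h3 (sub_nonneg.2 hab)

/-- The vector field `(e^u - x, 2 - x)`, which is the system in the variables `(x, log y)`, with
both variables truncated. -/
noncomputable def truncatedField (M : ℝ) (p : ℝ × ℝ) : ℝ × ℝ :=
  (Real.exp (clamp M p.2) - clamp M p.1, 2 - clamp M p.1)

theorem lipschitzWith_truncatedField {M : ℝ} (hM : 0 ≤ M) :
    LipschitzWith ⟨Real.exp M + 1, by positivity⟩ (truncatedField M) := by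
  refine LipschitzWith.of_dist_le_mul fun p q => ?_
  have h1 : |p.1 - q.1| ≤ dist p q := by rw [Prod.dist_eq, ← Real.dist_eq]; exact le_max_left _ _
  have h2 : |p.2 - q.2| ≤ dist p q := by rw [Prod.dist_eq, ← Real.dist_eq]; exact le_max_right _ _
  have c1 := (abs_clamp_sub_clamp_le M p.1 q.1).trans h1
  have c2 := (abs_clamp_sub_clamp_le M p.2 q.2).trans h2
  have e := (abs_exp_sub_exp_le (le_of_abs_le (abs_clamp_le hM p.2))
    (le_of_abs_le (abs_clamp_le hM q.2))).trans
      (mul_le_mul_of_nonneg_left c2 (Real.exp_pos M).le)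
  have hd : 0 ≤ Real.exp M * dist p q := by positivity
  change _ ≤ (Real.exp M + 1) * _
  rw [Prod.dist_eq, Real.dist_eq, Real.dist_eq, max_le_iff]
  obtain ⟨c3, c4⟩ := abs_le.1 c1
  obtain ⟨e3, e4⟩ := abs_le.1 e
  simp only [truncatedField]
  constructor <;> rw [abs_le] <;> constructor <;> linarith

theorem norm_truncatedField_le {M : ℝ} (hM : 0 ≤ M) (p : ℝ × ℝ) :
    ‖truncatedField M p‖ ≤ Real.exp M + M + 2 := by
  obtain ⟨c1, c2⟩ := abs_le.1 (abs_clamp_le hM p.1)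
  have c3 := Real.exp_le_exp.2 (le_of_abs_le (abs_clamp_le hM p.2))
  have c4 := Real.exp_pos (clamp M p.2)
  rw [Prod.norm_def, Real.norm_eq_abs, Real.norm_eq_abs, max_le_iff]
  simp only [truncatedField]
  constructor <;> rw [abs_le] <;> constructor <;> linarith

/-- The Lyapunov function in the variables `(x, log y)`. -/
noncomputable def lyapunov (x u : ℝ) : ℝ := (x - 2) ^ 2 / 2 + (Real.exp u - 2 * u)

/-- Coercivity of V in u: for u ≥ 0, e^u ≥ e u and e > 5/2; for u ≤ 0 the term -2u suffices. -/
theorem half_abs_le_exp_sub (u : ℝ) : |u| / 2 ≤ Real.exp u - 2 * u := by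
  rcases le_total 0 u with h | h
  · rw [abs_of_nonneg h]
    have h1 := Real.add_one_le_exp (u - 1)
    have h2 : Real.exp u = Real.exp (u - 1) * Real.exp 1 := by rw [← Real.exp_add]; ring_nf
    have h3 := Real.exp_one_gt_d9
    nlinarith
  · rw [abs_of_nonpos h]
    linarith [Real.exp_pos u]

theorem lyapunov_nonneg (x u : ℝ) : 0 ≤ lyapunov x u := by
  have := half_abs_le_exp_sub u
  rw [lyapunov]
  linarith [sq_nonneg (x - 2), abs_nonneg u]

/-- The strict box of size 2c + 4 fixes the truncation level at which the truncated and true fields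
agree on the sublevel set. -/
theorem abs_lt_of_lyapunov_le {x u c : ℝ} (h : lyapunov x u ≤ c) :
    |x| < 2 * c + 4 ∧ |u| < 2 * c + 4 := by
  have h0 := (lyapunov_nonneg x u).trans h
  have h1 := half_abs_le_exp_sub u
  have h2 := abs_nonneg u
  rw [lyapunov] at h
  refine ⟨?_, by linarith [sq_nonneg (x - 2)]⟩
  rw [abs_lt]
  constructor <;> nlinarith

theorem hasDerivAt_lyapunov {x u : ℝ → ℝ} {x' u' t : ℝ} (hx : HasDerivAt x x' t)
    (hu : HasDerivAt u u' t) :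
    HasDerivAt (fun s => lyapunov (x s) (u s))
      ((x t - 2) * x' + (Real.exp (u t) - 2) * u') t := by
  have := ((hx.sub_const 2).fun_pow 2).div_const 2 |>.fun_add (hu.exp.fun_sub (hu.const_mul 2))
  refine this.congr_deriv ?_
  push_cast
  ring

/-- Global forward existence in the variables `(x, log y)`, with the Lyapunov bound. -/
theorem exists_forward_log_solution (x₀ u₀ : ℝ) :
    ∃ x u : ℝ → ℝ, x 0 = x₀ ∧ u 0 = u₀ ∧
      ∀ t, 0 ≤ t → lyapunov (x t) (u t) ≤ lyapunov x₀ u₀ ∧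
        HasDerivAt x (Real.exp (u t) - x t) t ∧ HasDerivAt u (2 - x t) t := by
  set c := lyapunov x₀ u₀ with hc
  have hc0 : 0 ≤ c := lyapunov_nonneg _ _
  set M := 2 * c + 4 with hM
  have hM0 : 0 ≤ M := by positivity
  obtain ⟨Z, hZ0, hZ⟩ := exists_global_solution (L := ⟨Real.exp M + M + 2, by positivity⟩)
    (lipschitzWith_truncatedField hM0) (norm_truncatedField_le hM0) (x₀, u₀)
  have hx : ∀ t, HasDerivAt (fun s => (Z s).1) (truncatedField M (Z t)).1 t := fun t =>
    (ContinuousLinearMap.fst ℝ ℝ ℝ).hasFDerivAt.comp_hasDerivAt t (hZ t)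
  have hu : ∀ t, HasDerivAt (fun s => (Z s).2) (truncatedField M (Z t)).2 t := fun t =>
    (ContinuousLinearMap.snd ℝ ℝ ℝ).hasFDerivAt.comp_hasDerivAt t (hZ t)
  have htrue : ∀ t, |(Z t).1| ≤ M → |(Z t).2| ≤ M →
      truncatedField M (Z t) = (Real.exp (Z t).2 - (Z t).1, 2 - (Z t).1) := fun t h1 h2 => by
    rw [truncatedField, clamp_of_abs_le h1, clamp_of_abs_le h2]
  have hV := fun t => hasDerivAt_lyapunov (hx t) (hu t)
  have hxc : Continuous fun s => (Z s).1 :=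
    continuous_iff_continuousAt.2 fun t => (hx t).continuousAt
  have huc : Continuous fun s => (Z s).2 :=
    continuous_iff_continuousAt.2 fun t => (hu t).continuousAt
  have hVc : Continuous fun s => lyapunov (Z s).1 (Z s).2 :=
    continuous_iff_continuousAt.2 fun t => (hV t).continuousAt
  have hle : ∀ b, 0 ≤ b → lyapunov (Z b).1 (Z b).2 ≤ c := by
    intro b hb
    -- Continuous induction: where V ≤ c the point is strictly inside the box, so the true field
    -- acts nearby and V does not increase for a short time.
    have hsub : Icc 0 b ⊆ {t | lyapunov (Z t).1 (Z t).2 ≤ c} := by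
      refine IsClosed.Icc_subset_of_forall_mem_nhdsWithin
        ((isClosed_le hVc continuous_const).inter isClosed_Icc) (by simp [hZ0, hc]) ?_
      rintro t ⟨ht, -⟩
      obtain ⟨h1, h2⟩ := abs_lt_of_lyapunov_le ht
      have hnear : ∀ᶠ s in 𝓝 t, |(Z s).1| < M ∧ |(Z s).2| < M :=
        (hxc.abs.continuousAt.eventually (gt_mem_nhds h1)).and
          (huc.abs.continuousAt.eventually (gt_mem_nhds h2))
      obtain ⟨ε, hε, hb⟩ := Metric.eventually_nhds_iff_ball.1 hnear
      have hanti : AntitoneOn (fun s => lyapunov (Z s).1 (Z s).2) (Ico t (t + ε)) := by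
        refine antitoneOn_of_deriv_nonpos (convex_Ico _ _) hVc.continuousOn
          (fun s _ => (hV s).differentiableAt.differentiableWithinAt) (fun s hs => ?_)
        rw [interior_Ico] at hs
        obtain ⟨h3, h4⟩ := hb s (by
          rw [Real.ball_eq_Ioo]; exact ⟨by linarith [hs.1], hs.2⟩)
        rw [(hV s).deriv, htrue s h3.le h4.le]
        nlinarith [sq_nonneg ((Z s).1 - 2)]
      filter_upwards [Ioo_mem_nhdsGT (show t < t + ε by linarith)] with s hs
      exact (hanti ⟨le_rfl, by linarith⟩ (Ioo_subset_Ico_self hs) hs.1.le).trans ht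
    exact hsub ⟨hb, le_rfl⟩
  refine ⟨fun t => (Z t).1, fun t => (Z t).2, by simp [hZ0], by simp [hZ0], fun t ht => ?_⟩
  obtain ⟨h1, h2⟩ := abs_lt_of_lyapunov_le (hle t ht)
  have h3 := hx t
  have h4 := hu t
  rw [htrue t h1.le h2.le] at h3 h4
  exact ⟨hle t ht, h3, h4⟩

/-- Every positive initial point has a global forward solution, which tends to `(2, 2)`. -/
theorem exists_forward_solution (x₀ : ℝ) {y₀ : ℝ} (hy₀ : 0 < y₀) :
    ∃ x y : ℝ → ℝ, x 0 = x₀ ∧ y 0 = y₀ ∧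
      (∀ t, 0 ≤ t → HasDerivAt x (y t - x t) t ∧ HasDerivAt y ((2 - x t) * y t) t) ∧
      Tendsto x atTop (𝓝 2) ∧ Tendsto y atTop (𝓝 2) := by
  obtain ⟨x, u, hx0, hu0, h⟩ := exists_forward_log_solution x₀ (Real.log y₀)
  set c := lyapunov x₀ (Real.log y₀)
  set M := 2 * c + 4 with hM
  set y : ℝ → ℝ := fun t => Real.exp (u t) with hy
  have hx' : ∀ t, 0 ≤ t → HasDerivAt x (y t - x t) t := fun t ht => (h t ht).2.1
  have hy' : ∀ t, 0 ≤ t → HasDerivAt y ((2 - x t) * y t) t := fun t ht => by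
    rw [mul_comm]; exact (h t ht).2.2.exp
  have hV : ∀ t, 0 ≤ t →
      HasDerivAt (fun s => lyapunov (x s) (u s)) (-(x t - 2) ^ 2) t := fun t ht =>
    (hasDerivAt_lyapunov (h t ht).2.1 (h t ht).2.2).congr_deriv (by ring)
  have hb := fun t ht => abs_lt_of_lyapunov_le (h t ht).1
  have hyb : ∀ t, 0 ≤ t → |y t| ≤ Real.exp M := fun t ht => by
    rw [hy, abs_of_pos (Real.exp_pos _)]
    exact Real.exp_le_exp.2 (lt_of_abs_lt (hb t ht).2).le
  have hanti : AntitoneOn (fun s => lyapunov (x s) (u s)) (Ici 0) := by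
    refine antitoneOn_of_deriv_nonpos (convex_Ici _)
      (fun s hs => (hV s hs).continuousAt.continuousWithinAt) (fun s hs => ?_) (fun s hs => ?_)
    all_goals rw [interior_Ici] at hs
    · exact (hV s (le_of_lt hs)).differentiableAt.differentiableWithinAt
    · rw [(hV s (le_of_lt hs)).deriv]
      nlinarith [sq_nonneg (x s - 2)]
  obtain ⟨l, hl⟩ : ∃ l, Tendsto (fun s => lyapunov (x s) (u s)) atTop (𝓝 l) := by
    have ha : Antitone fun s => lyapunov (x (max s 0)) (u (max s 0)) := fun s t hst =>
      hanti (le_max_right s 0) (le_max_right t 0) (max_le_max_right 0 hst)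
    refine ⟨_, (tendsto_atTop_ciInf ha ⟨0, ?_⟩).congr' ?_⟩
    · rintro _ ⟨s, rfl⟩
      exact lyapunov_nonneg _ _
    · filter_upwards [eventually_ge_atTop 0] with s hs
      rw [max_eq_left hs]
  have hx2 : Tendsto x atTop (𝓝 2) := by
    have h1 : Tendsto (fun t => -(x t - 2) ^ 2) atTop (𝓝 0) := by
      -- V converges and V'' is bounded, so V' = -(x-2)² tends to 0.
      refine tendsto_deriv_zero_of_tendsto (K := 2 * ((M + 2) * (Real.exp M + M))) hV
        (f'' := fun t => -(2 * ((x t - 2) * (y t - x t)))) (fun t ht => ?_) (fun t ht => ?_) hl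
      · refine (((hx' t ht).sub_const 2).fun_pow 2).fun_neg.congr_deriv ?_
        push_cast
        ring
      · rw [abs_neg, abs_mul, abs_mul, abs_two]
        have b1 := (hb t ht).1
        have b2 : |x t - 2| ≤ M + 2 := by
          refine (abs_sub _ _).trans ?_
          rw [abs_two]
          linarith
        have b3 : |y t - x t| ≤ Real.exp M + M := (abs_sub _ _).trans (by linarith [hyb t ht])
        exact mul_le_mul_of_nonneg_left
          (mul_le_mul b2 b3 (abs_nonneg _) ((abs_nonneg _).trans b2)) two_pos.le
    have h2 : Tendsto (fun t => |x t - 2|) atTop (𝓝 0) := by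
      have := (h1.neg).sqrt
      simpa [Real.sqrt_sq_eq_abs] using this
    simpa using ((tendsto_zero_iff_abs_tendsto_zero _).2 h2).add_const 2
  refine ⟨x, y, hx0, by simp [hy, hu0, Real.exp_log hy₀], fun t ht => ⟨hx' t ht, hy' t ht⟩,
    hx2, ?_⟩
  have h1 : Tendsto (fun t => y t - x t) atTop (𝓝 0) := by
    -- The same argument applied to x → 2 gives x' = y - x → 0.
    refine tendsto_deriv_zero_of_tendsto (K := (M + 2) * Real.exp M + (Real.exp M + M)) hx'
      (fun t ht => (hy' t ht).fun_sub (hx' t ht)) (fun t ht => ?_) hx2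
    have b1 := (hb t ht).1
    have b2 : |2 - x t| ≤ M + 2 := by
      refine (abs_sub _ _).trans ?_
      rw [abs_two]
      linarith
    have b3 : |y t - x t| ≤ Real.exp M + M := (abs_sub _ _).trans (by linarith [hyb t ht])
    refine (abs_sub _ _).trans (add_le_add ?_ b3)
    rw [abs_mul]
    exact mul_le_mul b2 (hyb t ht) (abs_nonneg _) ((abs_nonneg _).trans b2)
  simpa using h1.add hx2

/-! ### Gluing the backward and forward pieces -/

/-- Two differentiable functions that agree to first order at `T` can be glued there. -/
theorem hasDerivAt_ite_le {f g F : ℝ → ℝ} {T : ℝ} (hfg : f T = g T)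
    (hf : ∀ t ≤ T, HasDerivAt f (F t) t) (hg : ∀ t, T ≤ t → HasDerivAt g (F t) t) (t : ℝ) :
    HasDerivAt (fun s => if s ≤ T then f s else g s) (F t) t := by
  rcases lt_trichotomy t T with h | h | h
  · refine (hf t h.le).congr_of_eventuallyEq ?_
    filter_upwards [Iio_mem_nhds h] with s hs
    rw [if_pos (le_of_lt hs)]
  · subst h
    rw [← hasDerivWithinAt_univ, ← Iic_union_Ici (a := t)]
    refine HasDerivWithinAt.union ?_ ?_
    · exact (hf t le_rfl).hasDerivWithinAt.congr (fun s hs => if_pos hs) (if_pos le_rfl)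
    · refine (hg t le_rfl).hasDerivWithinAt.congr (fun s hs => ?_) (by rw [if_pos le_rfl, hfg])
      rcases eq_or_lt_of_le (mem_Ici.1 hs) with rfl | hs'
      · rw [if_pos le_rfl, hfg]
      · rw [if_neg (not_le.2 hs')]
  · refine (hg t h.le).congr_of_eventuallyEq ?_
    filter_upwards [Ioi_mem_nhds h] with s hs
    rw [if_neg (not_le.2 hs)]

theorem exists_isHeteroclinic : ∃ x y : ℝ → ℝ, IsHeteroclinic aNR bNR (0, 0) (2, 2) x y := by
  obtain ⟨T, x₁, y₁, hpos, h₁, hx₁, hy₁⟩ := exists_backward_solution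
  obtain ⟨x₂, y₂, hx0, hy0, h₂, hx₂, hy₂⟩ := exists_forward_solution (x₁ T) hpos
  set x : ℝ → ℝ := fun s => if s ≤ T then x₁ s else x₂ (s - T) with hx
  set y : ℝ → ℝ := fun s => if s ≤ T then y₁ s else y₂ (s - T) with hy
  have hxb : ∀ t ≤ T, x t = x₁ t := fun t ht => if_pos ht
  have hyb : ∀ t ≤ T, y t = y₁ t := fun t ht => if_pos ht
  have hxf : ∀ t, T ≤ t → x t = x₂ (t - T) := fun t ht => by
    rcases eq_or_lt_of_le ht with rfl | ht
    · rw [hxb _ le_rfl, sub_self, hx0]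
    · exact if_neg (not_le.2 ht)
  have hyf : ∀ t, T ≤ t → y t = y₂ (t - T) := fun t ht => by
    rcases eq_or_lt_of_le ht with rfl | ht
    · rw [hyb _ le_rfl, sub_self, hy0]
    · exact if_neg (not_le.2 ht)
  refine ⟨x, y, fun t => ⟨?_, ?_⟩, ?_, ?_⟩
  · refine hasDerivAt_ite_le (g := fun s => x₂ (s - T)) (F := fun t => y t - x t)
      (by rw [sub_self, hx0]) (fun t ht => ?_) (fun t ht => ?_) t
    · rw [hxb t ht, hyb t ht]
      exact (h₁ t ht).1
    · rw [hxf t ht, hyf t ht]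
      exact (h₂ (t - T) (sub_nonneg.2 ht)).1.comp_sub_const t T
  · refine hasDerivAt_ite_le (g := fun s => y₂ (s - T))
      (F := fun t => aNR (x t) * y t - bNR (x t) * y t ^ 2)
      (by rw [sub_self, hy0]) (fun t ht => ?_) (fun t ht => ?_) t
    · rw [hxb t ht, hyb t ht]
      exact (h₁ t ht).2.congr_deriv (by rw [aNR, bNR]; ring)
    · rw [hxf t ht, hyf t ht]
      exact ((h₂ (t - T) (sub_nonneg.2 ht)).2.comp_sub_const t T).congr_deriv
        (by rw [aNR, bNR]; ring)
  · refine (hx₁.prodMk_nhds hy₁).congr' ?_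
    filter_upwards [eventually_le_atBot T] with t ht
    rw [hxb t ht, hyb t ht]
  · have hs : Tendsto (fun t : ℝ => t - T) atTop atTop :=
      tendsto_atTop_add_const_right _ (-T) tendsto_id
    refine ((hx₂.comp hs).prodMk_nhds (hy₂.comp hs)).congr' ?_
    filter_upwards [eventually_ge_atTop T] with t ht
    simp only [Function.comp]
    rw [hxf t ht, hyf t ht]

/-! ### The bound on x along a heteroclinic trajectory -/

section Bound

variable {x y : ℝ → ℝ}

theorem hasDerivAt_exp_integral {f : ℝ → ℝ} (hf : Continuous f) (t : ℝ) :
    HasDerivAt (fun t => Real.exp (∫ s in (0 : ℝ)..t, f s))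
      (Real.exp (∫ s in (0 : ℝ)..t, f s) * f t) t :=
  (intervalIntegral.integral_hasDerivAt_right (hf.intervalIntegrable _ _)
    hf.stronglyMeasurable.stronglyMeasurableAtFilter hf.continuousAt).exp

/-- The integrating factor exp ∫(x - 2) makes y times it constant, so y keeps the sign it has near
+∞. -/
theorem pos_of_tendsto_pos (hxc : Continuous x) (hy : ∀ t, HasDerivAt y ((2 - x t) * y t) t)
    {l : ℝ} (hl : 0 < l) (hlim : Tendsto y atTop (𝓝 l)) (t : ℝ) : 0 < y t := by
  have hE := hasDerivAt_exp_integral (f := fun s => x s - 2) (by fun_prop)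
  set E : ℝ → ℝ := fun t => Real.exp (∫ s in (0 : ℝ)..t, (x s - 2)) with hEdef
  have hEpos : ∀ t, 0 < E t := fun t => Real.exp_pos _
  have hd : ∀ t, HasDerivAt (fun t => y t * E t) 0 t := fun t =>
    ((hy t).fun_mul (hE t)).congr_deriv (by ring)
  obtain ⟨s, hs⟩ := (hlim.eventually (lt_mem_nhds hl)).exists
  have hconst : y t * E t = y s * E s :=
    is_const_of_deriv_eq_zero (fun t => (hd t).differentiableAt) (fun t => (hd t).deriv) t s
  have : 0 < y t * E t := hconst ▸ mul_pos hs (hEpos s)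
  exact (mul_pos_iff_of_pos_right (hEpos t)).1 this

/-- With w = y - 3x one has w' = -(1 + x) w - 3x², so w exp ∫(1 + x) is nonincreasing, and it tends
to 0 at -∞. -/
theorem le_three_mul_of_tendsto_zero (hx : ∀ t, HasDerivAt x (y t - x t) t)
    (hy : ∀ t, HasDerivAt y ((2 - x t) * y t) t)
    (hx0 : Tendsto x atBot (𝓝 0)) (hy0 : Tendsto y atBot (𝓝 0)) (t : ℝ) : y t ≤ 3 * x t := by
  have hxc : Continuous x := continuous_iff_continuousAt.2 fun t => (hx t).continuousAt
  have hE := hasDerivAt_exp_integral (f := fun s => 1 + x s) (by fun_prop)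
  set E : ℝ → ℝ := fun t => Real.exp (∫ s in (0 : ℝ)..t, (1 + x s)) with hEdef
  have hEpos : ∀ t, 0 < E t := fun t => Real.exp_pos _
  have hd : ∀ t, HasDerivAt (fun t => (y t - 3 * x t) * E t) (-(3 * x t ^ 2 * E t)) t := fun t =>
    (((hy t).fun_sub ((hx t).const_mul 3)).fun_mul (hE t)).congr_deriv (by ring)
  have hanti : Antitone fun t => (y t - 3 * x t) * E t :=
    antitone_of_deriv_nonpos (fun t => (hd t).differentiableAt) fun t => by
      rw [(hd t).deriv, neg_nonpos]
      exact mul_nonneg (by positivity) (hEpos t).le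
  -- Near -∞, x > -1 makes the integrating factor monotone, hence bounded by its value at T.
  obtain ⟨T, hT⟩ := eventually_atBot.1 (hx0.eventually (lt_mem_nhds (show (-1 : ℝ) < 0 by norm_num)))
  have hmono : MonotoneOn E (Iic T) := by
    refine monotoneOn_of_deriv_nonneg (convex_Iic _)
      (fun s _ => (hE s).continuousAt.continuousWithinAt)
      (fun s _ => (hE s).differentiableAt.differentiableWithinAt) (fun s hs => ?_)
    rw [interior_Iic] at hs
    rw [(hE s).deriv]
    exact mul_nonneg (hEpos s).le (by linarith [hT s (le_of_lt hs)])
  have hlim : Tendsto (fun t => (y t - 3 * x t) * E t) atBot (𝓝 0) := by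
    have h0 : Tendsto (fun t => y t - 3 * x t) atBot (𝓝 0) := by
      simpa using hy0.sub (hx0.const_mul 3)
    refine squeeze_zero_norm' (a := fun t => ‖y t - 3 * x t‖ * E T) ?_ (by
      simpa using h0.norm.mul_const (E T))
    filter_upwards [eventually_le_atBot T] with s hs
    rw [norm_mul, Real.norm_of_nonneg (hEpos s).le]
    exact mul_le_mul_of_nonneg_left (hmono hs (mem_Iic.2 le_rfl) hs) (norm_nonneg _)
  have hle : (y t - 3 * x t) * E t ≤ 0 := by
    refine ge_of_tendsto hlim ?_
    filter_upwards [eventually_le_atBot t] with s hs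
    exact hanti hs
  have := nonpos_of_mul_nonpos_left hle (hEpos t)
  linarith

/-- The last time before `t` at which a continuous function crosses the level `a` upwards. -/
theorem exists_last_crossing (hxc : Continuous x) {a s t : ℝ} (hst : s ≤ t) (hs : x s ≤ a)
    (ht : a < x t) : ∃ r < t, x r = a ∧ ∀ q ∈ Ioc r t, a < x q := by
  have hK : IsCompact (Icc s t ∩ {q | x q ≤ a}) :=
    isCompact_Icc.inter_right (isClosed_le hxc continuous_const)
  obtain ⟨r, ⟨hr, hra⟩, hmax⟩ := hK.exists_isGreatest ⟨s, ⟨le_rfl, hst⟩, hs⟩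
  have hrt : r < t := lt_of_le_of_ne hr.2 (by rintro rfl; exact absurd ht (not_lt.2 hra))
  have hgt : ∀ q ∈ Ioc r t, a < x q := fun q hq => by
    by_contra! h
    exact absurd (hmax ⟨⟨hr.1.trans hq.1.le, hq.2⟩, h⟩) (not_le.2 hq.1)
  refine ⟨r, hrt, le_antisymm hra ?_, hgt⟩
  refine ge_of_tendsto (hxc.continuousAt.continuousWithinAt (s := Ioi r)).tendsto ?_
  filter_upwards [Ioc_mem_nhdsGT hrt] with q hq
  exact (hgt q hq).le

theorem deriv_nonneg_of_le_right {x' r t : ℝ} (hrt : r < t) (hx : HasDerivAt x x' r)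
    (h : ∀ q ∈ Ioc r t, x r < x q) : 0 ≤ x' := by
  have := (hasDerivWithinAt_iff_tendsto_slope' (self_notMem_Ioi (a := r))).1
    (hx.hasDerivWithinAt (s := Ioi r))
  refine ge_of_tendsto this ?_
  filter_upwards [Ioc_mem_nhdsGT hrt] with q hq
  rw [slope_def_field]
  exact div_nonneg (sub_nonneg.2 (h q hq).le) (sub_nonneg.2 hq.1.le)

theorem log_three_lt_two : Real.log 3 < 2 := by
  have := Real.log_le_sub_one_of_pos (show (0 : ℝ) < 3 / 2 by norm_num)
  have h2 := Real.log_two_lt_d9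
  rw [Real.log_div (by norm_num) (by norm_num)] at this
  linarith

/-- Apply log s ≤ s - 1 to s = 6/v, then use v ≥ 2. -/
theorem sub_two_mul_log_le {v : ℝ} (h2 : 2 ≤ v) (h6 : v ≤ 6) :
    v - 2 * Real.log v ≤ 6 - 2 * Real.log 6 := by
  have hv : 0 < v := by linarith
  have h := Real.log_le_sub_one_of_pos (show 0 < 6 / v by positivity)
  rw [Real.log_div (by norm_num) hv.ne'] at h
  have : 6 / v - 1 ≤ (6 - v) / 2 := by
    rw [div_sub_one hv.ne']
    exact div_le_div_of_nonneg_left (by linarith) two_pos h2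
  linarith

theorem two_sub_le_sub_two_mul_log {v : ℝ} (hv : 0 < v) :
    2 - 2 * Real.log 2 ≤ v - 2 * Real.log v := by
  have h := Real.log_le_sub_one_of_pos (half_pos hv)
  rw [Real.log_div hv.ne' two_ne_zero] at h
  linarith

theorem IsHeteroclinic.le_bound (h : IsHeteroclinic aNR bNR (0, 0) (2, 2) x y) (t : ℝ) :
    x t ≤ 2 + 2 * Real.sqrt (2 - Real.log 3) := by
  obtain ⟨hsol, hbot, htop⟩ := h
  have hx : ∀ t, HasDerivAt x (y t - x t) t := fun t => (hsol t).1
  have hy : ∀ t, HasDerivAt y ((2 - x t) * y t) t := fun t =>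
    (hsol t).2.congr_deriv (by rw [aNR, bNR]; ring)
  have hxc : Continuous x := continuous_iff_continuousAt.2 fun t => (hx t).continuousAt
  have hx0 : Tendsto x atBot (𝓝 0) := hbot.fst_nhds
  have hy0 : Tendsto y atBot (𝓝 0) := hbot.snd_nhds
  have hpos := pos_of_tendsto_pos hxc hy two_pos htop.snd_nhds
  have hV : ∀ t, HasDerivAt (fun s => lyapunov (x s) (Real.log (y s))) (-(x t - 2) ^ 2) t :=
    fun t => (hasDerivAt_lyapunov (hx t) ((hy t).log (hpos t).ne')).congr_deriv (by
      rw [Real.exp_log (hpos t), mul_div_cancel_right₀ _ (hpos t).ne']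
      ring)
  have hanti : Antitone fun s => lyapunov (x s) (Real.log (y s)) :=
    antitone_of_deriv_nonpos (fun t => (hV t).differentiableAt) fun t => by
      rw [(hV t).deriv]
      nlinarith [sq_nonneg (x t - 2)]
  rcases le_or_gt (x t) 2 with ht | ht
  · linarith [Real.sqrt_nonneg (2 - Real.log 3)]
  obtain ⟨s, hs2, hst⟩ := ((hx0.eventually (gt_mem_nhds two_pos)).and
    (eventually_le_atBot t)).exists
  obtain ⟨r, hrt, hr, hgt⟩ := exists_last_crossing hxc hst hs2.le ht
  have hyr2 : 2 ≤ y r := by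
    have := deriv_nonneg_of_le_right hrt (hx r) (fun q hq => hr ▸ hgt q hq)
    linarith
  have hyr6 : y r ≤ 6 := by linarith [le_three_mul_of_tendsto_zero hx hy hx0 hy0 r]
  have hle := hanti hrt.le
  simp only [lyapunov, Real.exp_log (hpos _), hr] at hle
  have h1 := sub_two_mul_log_le hyr2 hyr6
  have h2 := two_sub_le_sub_two_mul_log (hpos t)
  have h3 : Real.log 6 = Real.log 2 + Real.log 3 := by
    rw [← Real.log_mul (by norm_num) (by norm_num)]
    norm_num
  -- This is H(x t) ≤ 4 - 2 log 3 divided by 2.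
  have h4 : ((x t - 2) / 2) ^ 2 ≤ 2 - Real.log 3 := by linarith
  linarith [Real.le_sqrt_of_sq_le h4]

end Bound

/-! ### The function H and its inverse on [2, ∞) -/

theorem H_eq (x : ℝ) : H aNR bNR 2 x = (x - 2) ^ 2 / 2 := by
  have : ∫ s in (2 : ℝ)..x, (2 - s) = -((x - 2) ^ 2 / 2) := by
    rw [intervalIntegral.integral_sub (by simp) (by simp)]
    simp only [intervalIntegral.integral_const, integral_id, smul_eq_mul]
    ring
  simp only [H, aNR, bNR, this, intervalIntegral.integral_zero]
  ring

theorem H_two_add_sqrt {h : ℝ} (hh : 0 ≤ h) : H aNR bNR 2 (2 + Real.sqrt (2 * h)) = h := by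
  rw [H_eq, add_sub_cancel_left, Real.sq_sqrt (by positivity)]
  ring

theorem two_add_sqrt_mem_Ici (h : ℝ) : 2 + Real.sqrt (2 * h) ∈ Ici (2 : ℝ) := by
  simp

theorem injOn_H : InjOn (H aNR bNR 2) (Ici 2) := by
  intro u hu v hv huv
  rw [H_eq, H_eq, div_left_inj' two_ne_zero,
    sq_eq_sq₀ (sub_nonneg.2 hu) (sub_nonneg.2 hv)] at huv
  linarith

theorem bijOn_H : BijOn (H aNR bNR 2) (Ici 2) (Ici 0) := by
  refine ⟨fun u _ => ?_, injOn_H, fun h hh => ⟨_, two_add_sqrt_mem_Ici h, H_two_add_sqrt hh⟩⟩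
  rw [H_eq]
  exact mem_Ici.2 (by positivity)

theorem invFunOn_H {h : ℝ} (hh : 0 ≤ h) :
    Function.invFunOn (H aNR bNR 2) (Ici 2) h = 2 + Real.sqrt (2 * h) := by
  have hex : ∃ u ∈ Ici (2 : ℝ), H aNR bNR 2 u = h :=
    ⟨_, two_add_sqrt_mem_Ici h, H_two_add_sqrt hh⟩
  exact injOn_H (Function.invFunOn_mem hex) (two_add_sqrt_mem_Ici h)
    ((Function.invFunOn_eq hex).trans (H_two_add_sqrt hh).symm)

end SmoluchowskiPoisson

theorem corollary2 :
    -- a heteroclinic trajectory from (0,0) to (2,2) exists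
    (∃ x y : ℝ → ℝ, SmoluchowskiPoisson.IsHeteroclinic
      SmoluchowskiPoisson.aNR SmoluchowskiPoisson.bNR (0, 0) (2, 2) x y) ∧
    -- the function H on [2,∞), and its inverse
    (∀ x : ℝ, 2 ≤ x →
      2 * SmoluchowskiPoisson.H SmoluchowskiPoisson.aNR SmoluchowskiPoisson.bNR 2 x
        = (x - 2) ^ 2) ∧
    Set.BijOn (SmoluchowskiPoisson.H SmoluchowskiPoisson.aNR SmoluchowskiPoisson.bNR 2)
      (Set.Ici 2) (Set.Ici 0) ∧
    (∀ h : ℝ, 0 ≤ h →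
      Function.invFunOn
        (SmoluchowskiPoisson.H SmoluchowskiPoisson.aNR SmoluchowskiPoisson.bNR 2)
        (Set.Ici 2) h = 2 + Real.sqrt (2 * h)) ∧
    -- the value X of the bound
    0 ≤ 4 - 2 * Real.log 3 ∧
    Function.invFunOn
        (SmoluchowskiPoisson.H SmoluchowskiPoisson.aNR SmoluchowskiPoisson.bNR 2)
        (Set.Ici 2) (4 - 2 * Real.log 3) = 2 + 2 * Real.sqrt (2 - Real.log 3) ∧
    -- X bounds the x variable of every heteroclinic trajectory
    (∀ x y : ℝ → ℝ, SmoluchowskiPoisson.IsHeteroclinic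
        SmoluchowskiPoisson.aNR SmoluchowskiPoisson.bNR (0, 0) (2, 2) x y →
      ∀ t : ℝ, x t ≤ 2 + 2 * Real.sqrt (2 - Real.log 3)) := by
  have hlog := SmoluchowskiPoisson.log_three_lt_two
  refine ⟨SmoluchowskiPoisson.exists_isHeteroclinic, fun x _ => ?_,
    SmoluchowskiPoisson.bijOn_H, fun h hh => SmoluchowskiPoisson.invFunOn_H hh, by linarith, ?_,
    fun x y hxy t => hxy.le_bound t⟩
  · rw [SmoluchowskiPoisson.H_eq]
    ring
  · rw [SmoluchowskiPoisson.invFunOn_H (by linarith),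
      show 2 * (4 - 2 * Real.log 3) = 2 ^ 2 * (2 - Real.log 3) by ring,
      Real.sqrt_mul (by norm_num), Real.sqrt_sq two_pos.le]
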